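/- Let $k$ be a field, let $k[X,Y]$ be the polynomial ring in two variables, and let $R$ be one of the subrings $R_1 = k[X^4, XY^3, Y^4]$ and $R_2 = k[X^5, XY^4, Y^5]$ of $k[X,Y]$. Let $\overline{R}$ be the integral closure of $R$ in its (total) ring of fractions $\mathrm{Q}(R)$. The strict closure of $R$ is $R^* = \{\alpha \in \overline{R} \mid \alpha \otimes 1 = 1 \otimes \alpha \text{ in } \overline{R} \otimes_R \overline{R}\}$. The weakly Arf closure of $R$ is $R^a = \bigcup_{n \ge 0} A_n$, where $A_0 = R$ and, for $n \geq 0$, $A_{n+1}$ is the subring of $\mathrm{Q}(R)$ generated over $A_n$ by all fractions $\frac{yz}{x}$ with $x, y, z \in A_n$, $x$ a non-zerodivisor, and $\frac{y}{x}, \frac{z}{x}$ integral over $A_n$. Then $R \subsetneq R^a = R^*$. Moreover, $R^a$ is a Noetherian ring that does not satisfy Serre's condition $(S_2)$; that is, there is a prime ideal $P$ of $R^a$ with $\operatorname{depth} (R^a)_P < \min\{2, \dim (R^a)_P\}$. -/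

import Mathlib

open scoped TensorProduct

noncomputable section

/-- The strict closure of `R` in an `R`-algebra `S`: the elements `α` of `S` such that
`α ⊗ 1 = 1 ⊗ α` in `S ⊗[R] S`. -/
def strictClosureIn (R S : Type*) [CommRing R] [CommRing S] [Algebra R S] : Subalgebra R S :=
  AlgHom.equalizer (Algebra.TensorProduct.includeLeft : S →ₐ[R] S ⊗[R] S)
    (Algebra.TensorProduct.includeRight : S →ₐ[R] S ⊗[R] S)

theorem mem_strictClosureIn {R S : Type*} [CommRing R] [CommRing S] [Algebra R S] {α : S} :
    α ∈ strictClosureIn R S ↔ α ⊗ₜ[R] (1 : S) = (1 : S) ⊗ₜ[R] α :=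
  Iff.rfl

/-- The strict closure `R^*` of `R` in the integral closure of `R` in its total ring of
fractions `FractionRing R`, regarded as an intermediate ring of `FractionRing R` over `R`. -/
def strictClosure (R : Type*) [CommRing R] : Subalgebra R (FractionRing R) :=
  (strictClosureIn R (integralClosure R (FractionRing R))).map
    (integralClosure R (FractionRing R)).val

/-- For an intermediate ring `A` of `Q` over `R`, where `Q` is the total ring of fractions of `A`,
the ring generated over `A` by all fractions `yz/x`, where `x` is a non-zerodivisor of `A` and
`y`, `z` are elements of `A` such that `y/x` and `z/x` are integral over `A`.
(Such an `x` is a unit of `Q`, so `u = y/x`, `v = z/x` and `q = yz/x` below.) -/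
def weaklyArfStep {R Q : Type*} [CommRing R] [CommRing Q] [Algebra R Q] (A : Subalgebra R Q) :
    Subalgebra R Q :=
  Algebra.adjoin R ((A : Set Q) ∪ {q : Q | ∃ x y z : A, x ∈ nonZeroDivisors A ∧
    (∃ u : Q, IsIntegral A u ∧ u * (x : Q) = y) ∧
    (∃ v : Q, IsIntegral A v ∧ v * (x : Q) = z) ∧
    q * (x : Q) = y * z})

/-- The tower `R = R₀ ⊆ R₁ ⊆ R₂ ⊆ ⋯` in the total ring of fractions of `R`. -/
def weaklyArfTower (R : Type*) [CommRing R] : ℕ → Subalgebra R (FractionRing R)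
  | 0 => ⊥
  | n + 1 => weaklyArfStep (weaklyArfTower R n)

/-- The weakly Arf closure `R^a` of `R`, the union of the tower `weaklyArfTower R`. -/
def weaklyArfClosure (R : Type*) [CommRing R] : Subalgebra R (FractionRing R) :=
  ⨆ n, weaklyArfTower R n

theorem weaklyArfTower_mono (R : Type*) [CommRing R] : Monotone (weaklyArfTower R) :=
  monotone_nat_of_le_succ fun _ _ hx => Algebra.subset_adjoin (Or.inl hx)

/-- The supremum defining `weaklyArfClosure` is the set-theoretic union. -/
theorem mem_weaklyArfClosure {R : Type*} [CommRing R] {q : FractionRing R} :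
    q ∈ weaklyArfClosure R ↔ ∃ n, q ∈ weaklyArfTower R n := by
  rw [weaklyArfClosure, ← SetLike.mem_coe,
    Subalgebra.coe_iSup_of_directed (weaklyArfTower_mono R).directed_le]
  simp

/-- The depth of a (Noetherian) local ring: the supremum of the lengths of the regular sequences
contained in the maximal ideal. -/
def localDepth (A : Type*) [CommRing A] [IsLocalRing A] : ℕ∞ :=
  ⨆ (rs : List A) (_ : (∀ r ∈ rs, r ∈ IsLocalRing.maximalIdeal A) ∧
    RingTheory.Sequence.IsRegular A rs), (rs.length : ℕ∞)

/-- Serre's condition `(S_n)` for a (Noetherian) ring: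
`depth A_P ≥ min {n, dim A_P}` for all prime ideals `P`. -/
def SerreCondition (n : ℕ) (A : Type*) [CommRing A] : Prop :=
  ∀ (P : Ideal A) [P.IsPrime],
    min (n : WithBot ℕ∞) (ringKrullDim (Localization.AtPrime P)) ≤
      (localDepth (Localization.AtPrime P) : WithBot ℕ∞)

end

/-! ### Depth and Serre's condition -/

/-! Write `P = k[X,Y]` and `R = k[X^n, XY^(n-1), Y^n]` with `n = 4` or `5`. Since `P` is normal and
integral over `R`, both closures can be compared inside `P`. There they turn out to be the span of
the same set of monomials, those with `IsGoodExponent`.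

The inclusion of the weakly Arf closure in the strict closure is formal: elements of the strict
closure slide across the tensor sign, so `uvx` is strict as soon as `x`, `ux`, `vx` are
(`mul_mul_mem_strictClosureIn`). The strict closure is bounded above by three tests
(`biCoeff_eq_zero_of_mem_strictClosure`): lying in `Frac R` forces degrees divisible by `n`;
comparing `P → P/(Y^(n-1))` with the substitution `Y = 0` restricts the exponent of `Y`; and an
`R`-balanced form on `P` excludes `X^i Y^(2n-i)` for `3 ≤ i < n`. Conversely, finitely many explicit
Arf fractions together with `R` produce every monomial that is left (`conclusion_of_generators`).
This closes the circle and also shows that the closure is a finitely generated `k`-algebra, hence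
Noetherian.

For `(S_2)`: the monomial `X^(n-1) Y^(n+1)` is missing from the closure, but its product with any
element of zero constant term is present. The ideal `M` of such elements is thus a colon ideal `(a :
b)` with `a ≠ 0`, which forces depth at most one at `M`, while `M` has height at least two. -/

theorem localDepth_le_one_of_forall_dvd_mul {A : Type*} [CommRing A] [IsLocalRing A] {a b : A}
    (ha : a ∈ nonZeroDivisors A) (hb : ¬ a ∣ b)
    (h : ∀ r ∈ IsLocalRing.maximalIdeal A, a ∣ r * b) : localDepth A ≤ 1 := by
  refine iSup₂_le ?_
  rintro rs ⟨hrs, hreg⟩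
  match rs, hrs, hreg with
  | [], _, _ => simp
  | [r], _, _ => simp
  | r₁ :: r₂ :: rs, hrs, hreg =>
    exfalso
    rw [RingTheory.Sequence.isRegular_cons_iff, RingTheory.Sequence.isRegular_cons_iff] at hreg
    obtain ⟨h₁, h₂, -⟩ := hreg
    obtain ⟨e₁, he₁⟩ := h r₁ (hrs r₁ (by simp))
    obtain ⟨e₂, he₂⟩ := h r₂ (hrs r₂ (by simp))
    -- Both sides equal `r₁ r₂ b / a`. Regularity of `r₂` modulo `r₁` then gives `r₁ ∣ e₁`, and
    -- cancelling `r₁` yields the forbidden `a ∣ b`.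
    have key : r₂ * e₁ = r₁ * e₂ := by
      refine (mul_cancel_left_mem_nonZeroDivisors ha).1 ?_
      linear_combination r₁ * he₂ - r₂ * he₁
    have hmk : ∀ x : A, (Submodule.Quotient.mk x : QuotSMulTop r₁ A) = 0 ↔ r₁ ∣ x := by
      intro x
      rw [Submodule.Quotient.mk_eq_zero, Submodule.mem_smul_pointwise_iff_exists]
      constructor
      · rintro ⟨y, -, rfl⟩
        exact ⟨y, rfl⟩
      · rintro ⟨y, rfl⟩
        exact ⟨y, trivial, rfl⟩
    have h0 : (Submodule.Quotient.mk e₁ : QuotSMulTop r₁ A) = 0 := by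
      refine h₂ ?_
      change r₂ • (Submodule.Quotient.mk e₁ : QuotSMulTop r₁ A) = r₂ • 0
      rw [smul_zero, ← Submodule.Quotient.mk_smul, hmk, smul_eq_mul, key]
      exact dvd_mul_right _ _
    obtain ⟨d, rfl⟩ := (hmk _).1 h0
    refine hb ⟨d, h₁ ?_⟩
    change r₁ * b = r₁ * (a * d)
    linear_combination he₁

/-- The colon description `M = (a : b)` survives localization: clearing denominators in `a ∣ b`
would give some `s ∉ M` with `a ∣ s * b`. -/
theorem localDepth_localization_le_one {A : Type*} [CommRing A] [IsDomain A] (M : Ideal A)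
    [M.IsPrime] {a b : A} (ha : a ≠ 0) (h : ∀ s, s ∈ M ↔ a ∣ s * b) :
    localDepth (Localization.AtPrime M) ≤ 1 := by
  set B := Localization.AtPrime M
  have hinj : Function.Injective (algebraMap A B) :=
    IsLocalization.injective B M.primeCompl_le_nonZeroDivisors
  have : IsDomain B := IsLocalization.isDomain_localization
    M.primeCompl_le_nonZeroDivisors
  refine localDepth_le_one_of_forall_dvd_mul (a := algebraMap A B a) (b := algebraMap A B b)
    (mem_nonZeroDivisors_of_ne_zero fun h0 => ha (hinj (by rw [h0, map_zero]))) ?_ ?_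
  · rintro ⟨c, hc⟩
    obtain ⟨⟨t, s⟩, hts⟩ := IsLocalization.surj M.primeCompl c
    refine s.2 ((h _).2 ⟨t, hinj ?_⟩)
    rw [map_mul, map_mul, ← hts, hc]
    ring
  · intro r hr
    obtain ⟨⟨t, s⟩, hts⟩ := IsLocalization.surj M.primeCompl r
    have ht : t ∈ M := by
      rw [← IsLocalization.AtPrime.to_map_mem_maximal_iff B M t, ← hts]
      exact Ideal.mul_mem_right _ _ hr
    obtain ⟨d, hd⟩ := (h t).1 ht
    have hu : IsUnit (algebraMap A B s) := IsLocalization.map_units B s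
    rw [← hu.dvd_mul_left (b := r * algebraMap A B b)]
    refine ⟨algebraMap A B d, ?_⟩
    rw [← map_mul, ← hd, map_mul, ← hts]
    ring

theorem not_serreCondition_two {A : Type*} [CommRing A] [IsDomain A] (p M : Ideal A)
    [p.IsPrime] [M.IsPrime] (hp : ⊥ < p) (hpM : p < M) {a b : A} (ha : a ≠ 0)
    (h : ∀ s, s ∈ M ↔ a ∣ s * b) : ¬ SerreCondition 2 A := by
  intro hS
  have h1 := hS M
  have hd : (localDepth (Localization.AtPrime M) : WithBot ℕ∞) ≤ ((1 : ℕ∞) : WithBot ℕ∞) :=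
    WithBot.coe_le_coe.2 (localDepth_localization_le_one M ha h)
  have hh : (2 : ℕ∞) ≤ M.height := by
    have h2 := Ideal.height_add_one_le_of_lt_of_isPrime hp
    have h3 := Ideal.height_add_one_le_of_lt_of_isPrime hpM
    calc (2 : ℕ∞) = 1 + 1 := by norm_num
      _ ≤ p.height + 1 := by gcongr; exact le_trans le_add_self h2
      _ ≤ _ := h3
  rw [IsLocalization.AtPrime.ringKrullDim_eq_height M] at h1
  have h4 : ((2 : ℕ∞) : WithBot ℕ∞) ≤ (M.height : WithBot ℕ∞) := WithBot.coe_le_coe.2 hh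
  have h5 : ((2 : ℕ) : WithBot ℕ∞) = ((2 : ℕ∞) : WithBot ℕ∞) := rfl
  rw [h5, min_eq_left h4] at h1
  exact absurd (WithBot.coe_le_coe.1 (h1.trans hd)) (by norm_num)

/-! ### The weakly Arf closure is contained in the strict closure -/

section

variable {R S : Type*} [CommRing R] [CommRing S] [Algebra R S]

theorem tmul_comm_of_mem_strictClosureIn {a : S} (ha : a ∈ strictClosureIn R S) (s t : S) :
    (s * a) ⊗ₜ[R] t = s ⊗ₜ[R] (a * t) := by
  have := congrArg (fun z => (s ⊗ₜ[R] t) * z) (mem_strictClosureIn.1 ha)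
  simpa [Algebra.TensorProduct.tmul_mul_tmul, mul_comm] using this

/-- Slide `ux`, then `x`, then `vx` across the tensor: `uvx ⊗ 1 = v ⊗ ux = vx ⊗ u = 1 ⊗ uvx`. -/
theorem mul_mul_mem_strictClosureIn {x u v : S} (hx : x ∈ strictClosureIn R S)
    (hu : u * x ∈ strictClosureIn R S) (hv : v * x ∈ strictClosureIn R S) :
    u * v * x ∈ strictClosureIn R S := by
  have h1 := tmul_comm_of_mem_strictClosureIn hu v 1
  have h2 := tmul_comm_of_mem_strictClosureIn hx v u
  have h3 := tmul_comm_of_mem_strictClosureIn hv 1 u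
  rw [mem_strictClosureIn]
  calc (u * v * x) ⊗ₜ[R] (1 : S) = (v * (u * x)) ⊗ₜ[R] 1 := by ring_nf
    _ = v ⊗ₜ (x * u) := by rw [h1]; ring_nf
    _ = (1 * (v * x)) ⊗ₜ u := by rw [← h2, one_mul]
    _ = 1 ⊗ₜ (u * v * x) := by rw [h3]; ring_nf

end

theorem strictClosure_le_integralClosure {R : Type*} [CommRing R] :
    strictClosure R ≤ integralClosure R (FractionRing R) := by
  rintro q ⟨s, -, rfl⟩
  exact s.2

theorem weaklyArfTower_le_strictClosure (R : Type*) [CommRing R] [IsDomain R] (n : ℕ) :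
    weaklyArfTower R n ≤ strictClosure R := by
  induction n with
  | zero => exact bot_le
  | succ n ih =>
    refine Algebra.adjoin_le ?_
    -- By induction the previous stage lies in the strict closure, so it is integral over `R`, and
    -- integrality is transitive.
    have hint : ∀ u : FractionRing R, IsIntegral (weaklyArfTower R n) u → IsIntegral R u := by
      intro u hu
      have : Algebra.IsIntegral R (weaklyArfTower R n) := ⟨fun x => by
        obtain ⟨s, -, hs⟩ := ih x.2
        refine (isIntegral_algHom_iff (weaklyArfTower R n).val Subtype.val_injective).1 ?_
        change IsIntegral R (x : FractionRing R)
        rw [← hs]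
        exact s.2⟩
      exact isIntegral_trans u hu
    rintro q (hq | ⟨x, y, z, hx, ⟨u, hu, hux⟩, ⟨v, hv, hvx⟩, hq⟩)
    · exact ih hq
    · obtain ⟨x', hx', hxx⟩ := ih x.2
      obtain ⟨y', hy', hyy⟩ := ih y.2
      obtain ⟨z', hz', hzz⟩ := ih z.2
      let u' : integralClosure R (FractionRing R) := ⟨u, hint u hu⟩
      let v' : integralClosure R (FractionRing R) := ⟨v, hint v hv⟩
      replace hxx : (x' : FractionRing R) = x := hxx
      replace hyy : (y' : FractionRing R) = y := hyy
      replace hzz : (z' : FractionRing R) = z := hzz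
      have h1 : u' * x' = y' := Subtype.ext (by
        change u * (x' : FractionRing R) = y'
        rw [hxx, hux, hyy])
      have h2 : v' * x' = z' := Subtype.ext (by
        change v * (x' : FractionRing R) = z'
        rw [hxx, hvx, hzz])
      refine ⟨u' * v' * x', mul_mul_mem_strictClosureIn hx' (h1 ▸ hy') (h2 ▸ hz'), ?_⟩
      change u * v * (x' : FractionRing R) = q
      rw [hxx]
      have hx0 : (x : FractionRing R) ≠ 0 := fun h0 => nonZeroDivisors.ne_zero hx (Subtype.ext h0)
      refine mul_right_cancel₀ hx0 ?_
      rw [hq, ← hux, ← hvx]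
      ring

theorem weaklyArfClosure_le_strictClosure (R : Type*) [CommRing R] [IsDomain R] :
    weaklyArfClosure R ≤ strictClosure R :=
  iSup_le (weaklyArfTower_le_strictClosure R)

open MvPolynomial in
/-- The coefficient of `X ^ i * Y ^ j` in a polynomial in two variables. -/
noncomputable def biCoeff {k : Type*} [Field k] (i j : ℕ) : MvPolynomial (Fin 2) k →ₗ[k] k :=
  lcoeff k (Finsupp.single 0 i + Finsupp.single 1 j)

/-- The subring `k[X ^ n, X * Y ^ (n - 1), Y ^ n]` of `k[X, Y]`. -/
noncomputable def monomialRing (k : Type*) [Field k] (n : ℕ) :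
    Subalgebra k (MvPolynomial (Fin 2) k) :=
  Algebra.adjoin k {MvPolynomial.X 0 ^ n, MvPolynomial.X 0 * MvPolynomial.X 1 ^ (n - 1),
    MvPolynomial.X 1 ^ n}

/-- The exponents of the monomials in the strict closure of `monomialRing k n`. -/
def IsGoodExponent (n i j : ℕ) : Prop :=
  n ∣ i + j ∧ (j = 0 ∨ n ≤ j + 1) ∧ ¬ (3 ≤ i ∧ i < n ∧ i + j = 2 * n)

namespace MonomialRing

open MvPolynomial

variable {k : Type*} [Field k]

/-! ### Coefficients -/

theorem biCoeff_ext {f g : MvPolynomial (Fin 2) k} (h : ∀ i j, biCoeff i j f = biCoeff i j g) :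
    f = g := by
  ext m
  have hm : m = Finsupp.single 0 (m 0) + Finsupp.single 1 (m 1) := by
    ext i
    fin_cases i <;> simp
  rw [hm]
  exact h _ _

theorem biCoeff_mul (a b i j : ℕ) (f : MvPolynomial (Fin 2) k) :
    biCoeff i j (X 0 ^ a * X 1 ^ b * f) =
      if a ≤ i ∧ b ≤ j then biCoeff (i - a) (j - b) f else 0 := by
  have hm : (X 0 ^ a * X 1 ^ b : MvPolynomial (Fin 2) k) =
      monomial (Finsupp.single 0 a + Finsupp.single 1 b) 1 := by
    rw [X_pow_eq_monomial, X_pow_eq_monomial, monomial_mul, one_mul]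
  have hle : (Finsupp.single 0 a + Finsupp.single 1 b : Fin 2 →₀ ℕ) ≤
      Finsupp.single 0 i + Finsupp.single 1 j ↔ a ≤ i ∧ b ≤ j := by
    rw [Finsupp.le_def, Fin.forall_fin_two]
    simp
  have hsub : (Finsupp.single 0 i + Finsupp.single 1 j -
      (Finsupp.single 0 a + Finsupp.single 1 b) : Fin 2 →₀ ℕ) =
      Finsupp.single 0 (i - a) + Finsupp.single 1 (j - b) := by
    ext l
    fin_cases l <;> simp
  rw [hm, biCoeff, lcoeff_apply, coeff_monomial_mul', if_congr hle rfl rfl, hsub, one_mul]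
  rfl

theorem biCoeff_one (i j : ℕ) :
    biCoeff i j (1 : MvPolynomial (Fin 2) k) = if i = 0 ∧ j = 0 then 1 else 0 := by
  have h : (0 : Fin 2 →₀ ℕ) = Finsupp.single 0 i + Finsupp.single 1 j ↔ i = 0 ∧ j = 0 := by
    rw [Finsupp.ext_iff, Fin.forall_fin_two]
    simp [eq_comm]
  rw [biCoeff, lcoeff_apply, coeff_one, if_congr h rfl rfl]

theorem biCoeff_monomial (a b i j : ℕ) :
    biCoeff i j (X 0 ^ a * X 1 ^ b : MvPolynomial (Fin 2) k) =
      if i = a ∧ j = b then 1 else 0 := by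
  rw [← mul_one (X 0 ^ a * X 1 ^ b), biCoeff_mul, biCoeff_one]
  grind

theorem biCoeff_zero_zero (f : MvPolynomial (Fin 2) k) : biCoeff 0 0 f = constantCoeff f := by
  simp [biCoeff, constantCoeff_eq]

theorem mem_of_forall_biCoeff (A : Subalgebra k (MvPolynomial (Fin 2) k))
    (f : MvPolynomial (Fin 2) k)
    (h : ∀ i j, biCoeff i j f ≠ 0 → X 0 ^ i * X 1 ^ j ∈ A) : f ∈ A := by
  rw [f.as_sum]
  refine sum_mem fun m hm => ?_
  have hm' : m = Finsupp.single 0 (m 0) + Finsupp.single 1 (m 1) := by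
    ext i
    fin_cases i <;> simp
  have h1 : monomial m (coeff m f) = coeff m f • (X 0 ^ m 0 * X 1 ^ m 1) := by
    rw [X_pow_eq_monomial, X_pow_eq_monomial, monomial_mul, ← hm', smul_monomial]
    simp
  rw [h1]
  refine A.smul_mem (h _ _ ?_) _
  rw [biCoeff, lcoeff_apply, ← hm']
  exact mem_support_iff.1 hm

/-- A linear condition that is stable under multiplication by the three generators holds for
all multiples by elements of `monomialRing k n`. -/
theorem induction_mul {n : ℕ} {p : MvPolynomial (Fin 2) k → Prop}
    (hC : ∀ c : k, p (C c)) (hadd : ∀ f g, p f → p g → p (f + g))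
    (hmul : ∀ f g, p f → p g → p (f * g))
    (h1 : p (X 0 ^ n * X 1 ^ 0)) (h2 : p (X 0 ^ 1 * X 1 ^ (n - 1))) (h3 : p (X 0 ^ 0 * X 1 ^ n))
    {r : MvPolynomial (Fin 2) k} (hr : r ∈ monomialRing k n) : p r := by
  refine Algebra.adjoin_induction ?_ hC (fun x y _ _ => hadd x y) (fun x y _ _ => hmul x y) hr
  rintro x (rfl | rfl | rfl)
  · simpa using h1
  · simpa using h2
  · simpa using h3

/-! ### Divisibility of degrees -/

/-- The projection of `k[X, Y]` onto the span of the monomials of degree divisible by `n`. -/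
noncomputable def veroneseProj (n : ℕ) :
    MvPolynomial (Fin 2) k →ₗ[k] MvPolynomial (Fin 2) k :=
  weightedHomogeneousComponent (fun _ => (1 : ZMod n)) 0

theorem biCoeff_veroneseProj (n i j : ℕ) (f : MvPolynomial (Fin 2) k) :
    biCoeff i j (veroneseProj n f) = if n ∣ i + j then biCoeff i j f else 0 := by
  classical
  have hw : Finsupp.weight (fun _ : Fin 2 => (1 : ZMod n))
      (Finsupp.single 0 i + Finsupp.single 1 j) = ((i + j : ℕ) : ZMod n) := by
    rw [map_add, Finsupp.weight_single, Finsupp.weight_single]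
    simp
  rw [biCoeff, lcoeff_apply, veroneseProj, coeff_weightedHomogeneousComponent, hw,
    if_congr (ZMod.natCast_eq_zero_iff _ _) rfl rfl]
  rfl

theorem veroneseProj_mul {n : ℕ} (hn : 1 ≤ n) {r : MvPolynomial (Fin 2) k}
    (hr : r ∈ monomialRing k n) (f : MvPolynomial (Fin 2) k) :
    veroneseProj n (r * f) = r * veroneseProj n f := by
  have key : ∀ a b : ℕ, n ∣ a + b → ∀ f : MvPolynomial (Fin 2) k,
      veroneseProj n (X 0 ^ a * X 1 ^ b * f) = X 0 ^ a * X 1 ^ b * veroneseProj n f := by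
    intro a b hab f
    refine biCoeff_ext fun i j => ?_
    rw [biCoeff_veroneseProj, biCoeff_mul, biCoeff_mul, biCoeff_veroneseProj]
    split_ifs with h1 h2 h3 h4 h5 <;> try rfl
    · exfalso
      apply h3
      have : i - a + (j - b) = i + j - (a + b) := by omega
      rw [this]
      exact Nat.dvd_sub h1 hab
    · exfalso
      apply h1
      have : i + j = i - a + (j - b) + (a + b) := by omega
      rw [this]
      exact dvd_add h5 hab
  revert f
  refine induction_mul (p := fun r => ∀ f, veroneseProj n (r * f) = r * veroneseProj n f)
    ?_ ?_ ?_ ?_ ?_ ?_ hr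
  · intro c f
    rw [← smul_eq_C_mul, ← smul_eq_C_mul, map_smul]
  · intro r s hr hs f
    rw [add_mul, map_add, hr, hs, add_mul]
  · intro r s hr hs f
    rw [mul_assoc, hr, hs, mul_assoc]
  · exact key n 0 (by simp)
  · exact key 1 (n - 1) (by rw [Nat.add_sub_cancel' hn])
  · exact key 0 n (by simp)

/-- The projection to degrees divisible by `n` is `R`-linear and fixes `1`, so it fixes `bf ∈ R`;
cancelling `b` shows that it fixes `f`. -/
theorem biCoeff_eq_zero_of_mul_mem {n : ℕ} (hn : 1 ≤ n) {b f : MvPolynomial (Fin 2) k}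
    (hb0 : b ≠ 0) (hb : b ∈ monomialRing k n) (hbf : b * f ∈ monomialRing k n) {i j : ℕ}
    (hij : ¬ n ∣ i + j) : biCoeff i j f = 0 := by
  have h1 : veroneseProj n (1 : MvPolynomial (Fin 2) k) = 1 := by
    refine biCoeff_ext fun i j => ?_
    rw [biCoeff_veroneseProj, biCoeff_one]
    split_ifs with h2 h3 h3 <;> try rfl
    exact absurd (by simp [h3]) h2
  have h2 : b * veroneseProj n f = b * f := by
    rw [← veroneseProj_mul hn hb]
    have := veroneseProj_mul hn hbf (1 : MvPolynomial (Fin 2) k)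
    rwa [h1, mul_one] at this
  rw [← mul_left_cancel₀ hb0 h2, biCoeff_veroneseProj, if_neg hij]

/-! ### Exponents of `Y` -/

/-- In `R` the exponent of `Y` is `0`, `n - 1`, `n` or at least `2n - 2`. The bound `4 ≤ n` is what
puts `n + 1` in the gap. -/
theorem biCoeff_eq_zero_of_mem {n : ℕ} (hn : 4 ≤ n) {r : MvPolynomial (Fin 2) k}
    (hr : r ∈ monomialRing k n) (i : ℕ) : biCoeff i (n + 1) r = 0 := by
  have key : ∀ a b : ℕ, (b = 0 ∨ b = n - 1 ∨ b = n) → ∀ f : MvPolynomial (Fin 2) k,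
      (∀ i j, j ≠ 0 → j ≠ n - 1 → j ≠ n → j < 2 * n - 2 → biCoeff i j f = 0) →
      ∀ i j, j ≠ 0 → j ≠ n - 1 → j ≠ n → j < 2 * n - 2 →
        biCoeff i j (X 0 ^ a * X 1 ^ b * f) = 0 := by
    intro a b hb f hf i j h0 h1 h2 h3
    rw [biCoeff_mul]
    split_ifs with h
    · rcases hb with rfl | hb
      · exact hf _ _ (by omega) (by omega) (by omega) (by omega)
      · exact hf _ _ (by omega) (by omega) (by omega) (by omega)
    · rfl
  have main := induction_mul (n := n) (p := fun r => ∀ f : MvPolynomial (Fin 2) k,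
      (∀ i j, j ≠ 0 → j ≠ n - 1 → j ≠ n → j < 2 * n - 2 → biCoeff i j f = 0) →
      ∀ i j, j ≠ 0 → j ≠ n - 1 → j ≠ n → j < 2 * n - 2 → biCoeff i j (r * f) = 0)
    ?_ ?_ ?_ (key _ _ (by simp)) (key _ _ (by simp)) (key _ _ (by simp)) hr
  · have := main 1 (fun i j h0 _ _ _ => by rw [biCoeff_one, if_neg (by tauto)]) i (n + 1)
      (by omega) (by omega) (by omega) (by omega)
    rwa [mul_one] at this
  · intro c f hf i j h0 h1 h2 h3
    rw [← smul_eq_C_mul, map_smul, hf i j h0 h1 h2 h3, smul_zero]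
  · intro r s hr hs f hf i j h0 h1 h2 h3
    rw [add_mul, map_add, hr f hf i j h0 h1 h2 h3, hs f hf i j h0 h1 h2 h3, add_zero]
  · intro r s hr hs f hf
    rw [mul_assoc]
    exact hr _ (hs f hf)

/-- The substitution `Y = 0`. -/
noncomputable def evalYZero : MvPolynomial (Fin 2) k →ₐ[k] MvPolynomial (Fin 2) k :=
  aeval ![X 0, 0]

theorem biCoeff_evalYZero {j : ℕ} (hj : j ≠ 0) (i : ℕ) (f : MvPolynomial (Fin 2) k) :
    biCoeff i j (evalYZero f) = 0 := by
  have h : ∀ f : MvPolynomial (Fin 2) k, ∀ i j, j ≠ 0 → biCoeff i j (evalYZero f) = 0 := by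
    intro f
    refine MvPolynomial.induction_on
      (motive := fun f => ∀ i j, j ≠ 0 → biCoeff i j (evalYZero f) = 0) f ?_ ?_ ?_
    · intro c i j hj
      rw [show (C c : MvPolynomial (Fin 2) k) = c • 1 by rw [smul_eq_C_mul, mul_one], map_smul,
        map_one, map_smul, biCoeff_one, if_neg (by tauto), smul_zero]
    · intro f g hf hg i j hj
      rw [map_add, map_add, hf i j hj, hg i j hj, add_zero]
    · intro f l hf i j hj
      rw [map_mul]
      fin_cases l
      · have := biCoeff_mul 1 0 i j (evalYZero f)
        have h2 : evalYZero (X 0 : MvPolynomial (Fin 2) k) = X 0 := by simp [evalYZero]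
        simp only [pow_one, pow_zero, mul_one] at this
        change biCoeff i j (evalYZero f * evalYZero (X 0)) = 0
        rw [h2, mul_comm, this]
        split_ifs
        · exact hf _ _ (by omega)
        · rfl
      · simp [evalYZero]
  exact h f i j hj

theorem biCoeff_eq_zero_of_sub_mem {n : ℕ} {f : MvPolynomial (Fin 2) k}
    (h : f - evalYZero f ∈ Ideal.span {(X 1 ^ (n - 1) : MvPolynomial (Fin 2) k)}) {i j : ℕ}
    (h0 : j ≠ 0) (hj : j + 1 < n) : biCoeff i j f = 0 := by
  obtain ⟨g, hg⟩ := Ideal.mem_span_singleton.1 h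
  have h1 := congrArg (biCoeff i j) hg
  have h2 := biCoeff_mul 0 (n - 1) i j g
  rw [pow_zero, one_mul] at h2
  rw [map_sub, biCoeff_evalYZero h0, sub_zero, h2, if_neg (by omega)] at h1
  exact h1

/-- Modulo `Y^(n-1)` the generators `XY^(n-1)` and `Y^n` vanish, as they do under `Y = 0`, while
`X^n` is fixed. The two maps therefore also agree on the strict closure. -/
theorem mk_evalYZero {n : ℕ} (hn : 2 ≤ n) {r : MvPolynomial (Fin 2) k}
    (hr : r ∈ monomialRing k n) :
    Ideal.Quotient.mk (Ideal.span {(X 1 ^ (n - 1) : MvPolynomial (Fin 2) k)}) (evalYZero r) =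
      Ideal.Quotient.mk _ r := by
  have h0 : n - 1 ≠ 0 := by omega
  have hn0 : n ≠ 0 := by omega
  have hz : Ideal.Quotient.mk (Ideal.span {(X 1 ^ (n - 1) : MvPolynomial (Fin 2) k)})
      (X 1 ^ (n - 1)) = 0 :=
    Ideal.Quotient.eq_zero_iff_mem.2 (Ideal.mem_span_singleton_self _)
  have hz' : Ideal.Quotient.mk (Ideal.span {(X 1 ^ (n - 1) : MvPolynomial (Fin 2) k)})
      (X 1 ^ n) = 0 :=
    Ideal.Quotient.eq_zero_iff_mem.2
      (Ideal.mem_span_singleton.2 (pow_dvd_pow _ (Nat.sub_le _ _)))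
  refine induction_mul (p := fun r => Ideal.Quotient.mk _ (evalYZero r) = Ideal.Quotient.mk _ r)
    ?_ ?_ ?_ ?_ ?_ ?_ hr
  · intro c
    simp [evalYZero]
  · intro f g hf hg
    rw [map_add, map_add, hf, hg, map_add]
  · intro f g hf hg
    rw [map_mul, map_mul, hf, hg, map_mul]
  · simp [evalYZero]
  · rw [map_mul, map_mul, map_mul, hz]
    simp [evalYZero, h0]
  · rw [map_mul, map_mul, map_mul, hz']
    simp [evalYZero, hn0]

/-! ### A balanced form detecting the exponents in degree two -/

/-- The form `(f, g) ↦ f_w g_0 + f_{w - p} g_p + f_{w - q} g_q`, where `w = (a, 2n - a)`,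
`p = (1, n - 1)`, `q = (0, n)` and the indices denote coefficients. -/
noncomputable def balancedForm (n a : ℕ) :
    MvPolynomial (Fin 2) k →+ MvPolynomial (Fin 2) k →+ k :=
  AddMonoidHom.mk' (fun f => AddMonoidHom.mk' (fun g =>
      biCoeff a (2 * n - a) f * biCoeff 0 0 g +
      biCoeff (a - 1) (n + 1 - a) f * biCoeff 1 (n - 1) g +
      biCoeff a (n - a) f * biCoeff 0 n g) (by intro g h; simp only [map_add]; ring))
    (by
      intro f g
      refine AddMonoidHom.ext fun h => ?_
      simp only [map_add, AddMonoidHom.mk'_apply, AddMonoidHom.add_apply]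
      ring)

theorem balancedForm_apply (n a : ℕ) (f g : MvPolynomial (Fin 2) k) :
    balancedForm n a f g = biCoeff a (2 * n - a) f * biCoeff 0 0 g +
      biCoeff (a - 1) (n + 1 - a) f * biCoeff 1 (n - 1) g +
      biCoeff a (n - a) f * biCoeff 0 n g := rfl

/-- It suffices to move generators across. Moving `XY^(n-1)` or `Y^n` matches the terms at `w - p`
or `w - q` with the term at `w`. All other terms vanish on exponent grounds: `3 ≤ a` makes the
`Y`-exponents of `w - 2p`, `w - p - q` and `w - 2q` negative, and `a < n` kills multiples of `X^n`.
-/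
theorem balancedForm_mul {n a : ℕ} (ha : 3 ≤ a) (han : a < n) {r : MvPolynomial (Fin 2) k}
    (hr : r ∈ monomialRing k n) (f g : MvPolynomial (Fin 2) k) :
    balancedForm n a (r * f) g = balancedForm n a f (r * g) := by
  revert f g
  refine induction_mul (p := fun r => ∀ f g : MvPolynomial (Fin 2) k,
    balancedForm n a (r * f) g = balancedForm n a f (r * g)) ?_ ?_ ?_ ?_ ?_ ?_ hr
  · intro c f g
    simp only [balancedForm_apply, ← smul_eq_C_mul, map_smul, smul_eq_mul]
    ring
  · intro r s hr hs f g
    rw [add_mul, map_add, AddMonoidHom.add_apply, hr, hs, add_mul, map_add]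
  · intro r s hr hs f g
    rw [mul_assoc, hr, hs, mul_comm r s, mul_assoc]
  · intro f g
    simp only [balancedForm_apply, biCoeff_mul]
    rw [if_neg (by omega), if_neg (by omega), if_neg (by omega), if_neg (by omega),
      if_neg (by omega), if_neg (by omega)]
    ring
  · intro f g
    simp only [balancedForm_apply, biCoeff_mul]
    rw [if_pos (by omega), if_neg (by omega), if_neg (by omega), if_neg (by omega),
      if_pos (by omega), if_neg (by omega), show 2 * n - a - (n - 1) = n + 1 - a by omega]
    simp
  · intro f g
    simp only [balancedForm_apply, biCoeff_mul]
    rw [if_pos (by omega), if_neg (by omega), if_neg (by omega), if_neg (by omega),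
      if_neg (by omega), if_pos (by omega), show 2 * n - a - n = n - a by omega]
    simp

theorem balancedForm_one_right {n : ℕ} (hn : n ≠ 0) (a : ℕ) (f : MvPolynomial (Fin 2) k) :
    balancedForm n a f 1 = biCoeff a (2 * n - a) f := by
  simp [balancedForm_apply, biCoeff_one, hn]

theorem balancedForm_one_left {n a : ℕ} (ha : 3 ≤ a) (f : MvPolynomial (Fin 2) k) :
    balancedForm n a 1 f = 0 := by
  rw [balancedForm_apply, biCoeff_one, biCoeff_one, biCoeff_one, if_neg (by omega),
    if_neg (by omega), if_neg (by omega)]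
  simp

/-! ### Comparing the total ring of fractions of a subring with that of the ring -/

section Embedding

variable (R P : Type*) [CommRing R] [IsDomain R] [CommRing P] [IsDomain P] [Algebra R P]
  [FaithfulSMul R P]

omit [IsDomain R] [IsDomain P] in
theorem algebraMap_fractionRing_injective :
    Function.Injective (IsScalarTower.toAlgHom R R (FractionRing P)) := by
  change Function.Injective (algebraMap R (FractionRing P))
  rw [IsScalarTower.algebraMap_eq R P (FractionRing P)]
  exact (IsFractionRing.injective P (FractionRing P)).comp (FaithfulSMul.algebraMap_injective R P)

/-- The embedding of the fraction field of `R` into that of `P`. -/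
noncomputable def fracEmb : FractionRing R →ₐ[R] FractionRing P :=
  IsFractionRing.liftAlgHom (algebraMap_fractionRing_injective R P)

/-- The elements of `P` which lie in an intermediate ring of the fraction field of `R`. -/
noncomputable def contraction (A : Subalgebra R (FractionRing R)) : Subalgebra R P :=
  (A.map (fracEmb R P)).comap (IsScalarTower.toAlgHom R P (FractionRing P))

variable {R P}

theorem fracEmb_injective : Function.Injective (fracEmb R P) :=
  (fracEmb R P).toRingHom.injective

theorem mem_contraction {A : Subalgebra R (FractionRing R)} {f : P} :
    f ∈ contraction R P A ↔ ∃ q ∈ A, fracEmb R P q = algebraMap P (FractionRing P) f :=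
  Iff.rfl

theorem contraction_mono {A B : Subalgebra R (FractionRing R)} (h : A ≤ B) :
    contraction R P A ≤ contraction R P B := by
  rintro f ⟨q, hq, hqf⟩
  exact ⟨q, h hq, hqf⟩

theorem exists_mul_eq_of_mem_contraction {A : Subalgebra R (FractionRing R)} {f : P}
    (hf : f ∈ contraction R P A) :
    ∃ a b : R, b ≠ 0 ∧ algebraMap R P b * f = algebraMap R P a := by
  obtain ⟨q, -, hq⟩ := mem_contraction.1 hf
  obtain ⟨a, b, hb, rfl⟩ := IsFractionRing.div_surjective (A := R) q
  have hb0 : b ≠ 0 := nonZeroDivisors.ne_zero hb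
  have hb1 : algebraMap R (FractionRing P) b ≠ 0 := fun h =>
    hb0 (algebraMap_fractionRing_injective R P (by
      change algebraMap R (FractionRing P) b = algebraMap R (FractionRing P) 0
      rw [h, map_zero]))
  refine ⟨a, b, hb0, IsFractionRing.injective P (FractionRing P) ?_⟩
  rw [map_mul, ← hq, map_div₀, AlgHom.commutes, AlgHom.commutes,
    ← IsScalarTower.algebraMap_apply, ← IsScalarTower.algebraMap_apply,
    mul_div_cancel₀ _ hb1]

theorem contraction_bot {f : P} (hf : f ∈ contraction R P ⊥) : ∃ r : R, algebraMap R P r = f := by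
  obtain ⟨q, hq, hqf⟩ := mem_contraction.1 hf
  obtain ⟨r, rfl⟩ := Algebra.mem_bot.1 hq
  rw [AlgHom.commutes, IsScalarTower.algebraMap_apply R P] at hqf
  exact ⟨r, IsFractionRing.injective P (FractionRing P) hqf⟩

/-! ### Normal overrings and tests for membership in the strict closure. -/

section Normal

variable [IsIntegrallyClosed P]

theorem exists_algebraMap_eq_fracEmb {q : FractionRing R} (hq : IsIntegral R q) :
    ∃ f : P, algebraMap P (FractionRing P) f = fracEmb R P q :=
  IsIntegrallyClosed.isIntegral_iff.1 ((hq.map (fracEmb R P)).tower_top)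

/-- An intermediate ring that is integral over `R` embeds into every normal overring of `R`. -/
theorem exists_algHom_of_le_integralClosure {A : Subalgebra R (FractionRing R)}
    (hA : A ≤ integralClosure R (FractionRing R)) :
    ∃ φ : A →ₐ[R] P, ∀ q : A, algebraMap P (FractionRing P) (φ q) = fracEmb R P q := by
  let e := AlgEquiv.ofInjective (IsScalarTower.toAlgHom R P (FractionRing P))
    (IsFractionRing.injective P (FractionRing P))
  let g := AlgHom.codRestrict ((fracEmb R P).comp A.val)
    (IsScalarTower.toAlgHom R P (FractionRing P)).range
    fun q => exists_algebraMap_eq_fracEmb (hA q.2)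
  exact ⟨e.symm.toAlgHom.comp g, fun q => congrArg Subtype.val (e.apply_symm_apply (g q))⟩

theorem exists_ringHom_range_eq_contraction {A : Subalgebra R (FractionRing R)}
    (hA : A ≤ integralClosure R (FractionRing R)) :
    ∃ φ : A →+* P, Function.Injective φ ∧ ∀ f, (∃ q, φ q = f) ↔ f ∈ contraction R P A := by
  obtain ⟨φ, hφ⟩ := exists_algHom_of_le_integralClosure (P := P) hA
  refine ⟨φ.toRingHom, fun x y hxy => ?_, fun f => ?_⟩
  · refine Subtype.ext (fracEmb_injective (P := P) ?_)
    rw [← hφ, ← hφ]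
    exact congrArg _ hxy
  · constructor
    · rintro ⟨q, rfl⟩
      exact ⟨q, q.2, (hφ q).symm⟩
    · rintro ⟨q, hq, hqf⟩
      exact ⟨⟨q, hq⟩, IsFractionRing.injective P (FractionRing P) ((hφ _).trans hqf)⟩

/-- A biadditive form on `P` that is balanced over `R` cannot distinguish `f ⊗ 1` from `1 ⊗ f`
for `f` in the strict closure of `R`. -/
theorem apply_one_eq_of_mem_strictClosure {M : Type*} [AddCommMonoid M] (B : P →+ P →+ M)
    (hB : ∀ (r : R) (f g : P), B (algebraMap R P r * f) g = B f (algebraMap R P r * g))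
    {f : P} (hf : f ∈ contraction R P (strictClosure R)) : B f 1 = B 1 f := by
  obtain ⟨φ, hφ⟩ := exists_algHom_of_le_integralClosure (R := R) (P := P) le_rfl
  obtain ⟨q, ⟨s, hs, rfl⟩, hq⟩ := mem_contraction.1 hf
  have hsf : φ s = f := IsFractionRing.injective P (FractionRing P) ((hφ s).trans hq)
  let B' := TensorProduct.liftAddHom (R := R)
    ((B.compl₂ φ.toRingHom.toAddMonoidHom).comp φ.toRingHom.toAddMonoidHom) (by
      intro r x y
      change B (φ (r • x)) (φ y) = B (φ x) (φ (r • y))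
      rw [map_smul φ, map_smul φ, Algebra.smul_def, Algebra.smul_def]
      exact hB r _ _)
  have h : B (φ s) (φ 1) = B (φ 1) (φ s) := congrArg B' (mem_strictClosureIn.1 hs)
  rwa [map_one, hsf] at h

/-- Two ring homomorphisms on `P` which agree on `R` agree on the strict closure of `R`. -/
theorem eq_of_mem_strictClosure {T : Type*} [CommRing T] (φ ψ : P →+* T)
    (h : ∀ r, φ (algebraMap R P r) = ψ (algebraMap R P r)) {f : P}
    (hf : f ∈ contraction R P (strictClosure R)) : φ f = ψ f := by
  have := apply_one_eq_of_mem_strictClosure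
    ((AddMonoidHom.mul.comp φ.toAddMonoidHom).compl₂ ψ.toAddMonoidHom) (by
      intro r m n
      simp [h]
      ring) hf
  simpa using this

end Normal

/-- The Arf operation with `u`, `v` in `P` in place of `y/x`, `z/x`: they are integral because `P`
is, and `x`, `ux`, `vx` already occur at a common stage `N` of the tower. -/
theorem mul_mul_mem_contraction_weaklyArfClosure [Algebra.IsIntegral R P] {x u v : P}
    (hx0 : x ≠ 0) (hx : x ∈ contraction R P (weaklyArfClosure R))
    (hu : u * x ∈ contraction R P (weaklyArfClosure R))
    (hv : v * x ∈ contraction R P (weaklyArfClosure R)) :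
    u * v * x ∈ contraction R P (weaklyArfClosure R) := by
  obtain ⟨x', hx', hxx⟩ := mem_contraction.1 hx
  obtain ⟨y', hy', hyy⟩ := mem_contraction.1 hu
  obtain ⟨z', hz', hzz⟩ := mem_contraction.1 hv
  obtain ⟨n₁, h₁⟩ := mem_weaklyArfClosure.1 hx'
  obtain ⟨n₂, h₂⟩ := mem_weaklyArfClosure.1 hy'
  obtain ⟨n₃, h₃⟩ := mem_weaklyArfClosure.1 hz'
  set N := max n₁ (max n₂ n₃)
  replace h₁ := weaklyArfTower_mono R (show n₁ ≤ N by omega) h₁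
  replace h₂ := weaklyArfTower_mono R (show n₂ ≤ N by omega) h₂
  replace h₃ := weaklyArfTower_mono R (show n₃ ≤ N by omega) h₃
  have hx1 : algebraMap P (FractionRing P) x ≠ 0 := fun h =>
    hx0 (IsFractionRing.injective P (FractionRing P) (by rw [h, map_zero]))
  have hx2 : x' ≠ 0 := by
    rintro rfl
    exact hx1 (by rw [← hxx, map_zero])
  have hfrac : ∀ (y : FractionRing R) (w : P),
      fracEmb R P y = algebraMap P (FractionRing P) (w * x) →
      fracEmb R P (y / x') = algebraMap P (FractionRing P) w ∧
        IsIntegral (weaklyArfTower R N) (y / x') := by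
    intro y w hy
    have h : fracEmb R P (y / x') = algebraMap P (FractionRing P) w := by
      rw [map_div₀, hy, hxx, map_mul, mul_div_cancel_right₀ _ hx1]
    refine ⟨h, ?_⟩
    have h' : IsIntegral R (y / x') := by
      refine (isIntegral_algHom_iff (fracEmb R P) fracEmb_injective).1 ?_
      rw [h]
      exact (Algebra.IsIntegral.isIntegral (R := R) w).map
        (IsScalarTower.toAlgHom R P (FractionRing P))
    exact h'.tower_top
  obtain ⟨hu1, hu2⟩ := hfrac y' u hyy
  obtain ⟨hv1, hv2⟩ := hfrac z' v hzz
  refine mem_contraction.2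
    ⟨y' / x' * (z' / x') * x', mem_weaklyArfClosure.2 ⟨N + 1, ?_⟩, ?_⟩
  · refine Algebra.subset_adjoin (Or.inr ⟨⟨x', h₁⟩, ⟨y', h₂⟩, ⟨z', h₃⟩, ?_, ⟨_, hu2, ?_⟩,
      ⟨_, hv2, ?_⟩, ?_⟩)
    · exact mem_nonZeroDivisors_of_ne_zero fun h => hx2 (congrArg Subtype.val h)
    · exact div_mul_cancel₀ _ hx2
    · exact div_mul_cancel₀ _ hx2
    · change y' / x' * (z' / x') * x' * x' = y' * z'
      field_simp
  · rw [map_mul, map_mul, hu1, hv1, hxx, map_mul, map_mul]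

theorem eq_of_contraction_le [IsIntegrallyClosed P] {A : Subalgebra R (FractionRing R)}
    (hA : A ≤ strictClosure R)
    (h : contraction R P (strictClosure R) ≤ contraction R P A) : A = strictClosure R := by
  refine le_antisymm hA fun q hq => ?_
  obtain ⟨f, hf⟩ := exists_algebraMap_eq_fracEmb (P := P) (strictClosure_le_integralClosure hq)
  obtain ⟨q', hq', hf'⟩ := mem_contraction.1 (h (mem_contraction.2 ⟨q, hq, hf.symm⟩))
  have : q' = q := fracEmb_injective (P := P) (hf'.trans hf)
  exact this ▸ hq'

end Embedding

theorem isIntegral_monomialRing {n : ℕ} (hn : 1 ≤ n) :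
    Algebra.IsIntegral (monomialRing k n) (MvPolynomial (Fin 2) k) := by
  have hpow : ∀ (l : Fin 2), (X l ^ n : MvPolynomial (Fin 2) k) ∈ monomialRing k n := by
    intro l
    refine Algebra.subset_adjoin ?_
    fin_cases l <;> simp
  have hX : ∀ l : Fin 2, IsIntegral (monomialRing k n) (X l : MvPolynomial (Fin 2) k) := fun l =>
    IsIntegral.of_pow hn (isIntegral_algebraMap (x := (⟨X l ^ n, hpow l⟩ : monomialRing k n)))
  refine ⟨fun f => ?_⟩
  refine MvPolynomial.induction_on f ?_ ?_ ?_
  · intro c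
    exact isIntegral_algebraMap (x := algebraMap k (monomialRing k n) c)
  · intro f g hf hg
    exact hf.add hg
  · intro f l hf
    exact hf.mul (hX l)

/-! ### The strict closure -/

/-- An exponent can fail to be good in three ways, each excluded by its own test: degree by the
Veronese projection, degree `2n` by the balanced form, small positive `j` by the substitution `Y =
0`. -/
theorem biCoeff_eq_zero_of_mem_strictClosure {n : ℕ} (hn : 4 ≤ n) {f : MvPolynomial (Fin 2) k}
    (hf : f ∈ contraction (monomialRing k n) (MvPolynomial (Fin 2) k)
      (strictClosure (monomialRing k n))) {i j : ℕ}
    (hij : ¬ IsGoodExponent n i j) : biCoeff i j f = 0 := by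
  by_cases hdvd : n ∣ i + j
  swap
  · obtain ⟨a, b, hb, hab⟩ := exists_mul_eq_of_mem_contraction hf
    refine biCoeff_eq_zero_of_mul_mem (b := b) (by omega) (fun h => hb (Subtype.ext h)) b.2 ?_ hdvd
    exact (show (b : MvPolynomial (Fin 2) k) * f = a from hab) ▸ a.2
  by_cases h3 : 3 ≤ i ∧ i < n ∧ i + j = 2 * n
  · obtain ⟨h3, h4, h5⟩ := h3
    have := apply_one_eq_of_mem_strictClosure (balancedForm n i)
      (fun r x y => balancedForm_mul h3 h4 r.2 x y) hf
    rw [balancedForm_one_left h3, balancedForm_one_right (by omega)] at this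
    rwa [show j = 2 * n - i by omega]
  · have hj : j ≠ 0 ∧ j + 1 < n := by
      unfold IsGoodExponent at hij
      by_contra hcon
      exact hij ⟨hdvd, by omega, h3⟩
    refine biCoeff_eq_zero_of_sub_mem (n := n) ?_ hj.1 hj.2
    exact Ideal.Quotient.eq.1 (eq_of_mem_strictClosure (Ideal.Quotient.mk _)
      ((Ideal.Quotient.mk _).comp evalYZero.toRingHom)
      (fun r => (mk_evalYZero (by omega) r.2).symm) hf)

/-! ### The weakly Arf closure -/

variable (k) in
/-- The weakly Arf closure of `monomialRing k n`, as a subring of `k[X, Y]`. -/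
noncomputable def arfPolynomials (n : ℕ) :
    Subalgebra (monomialRing k n) (MvPolynomial (Fin 2) k) :=
  contraction (monomialRing k n) (MvPolynomial (Fin 2) k) (weaklyArfClosure (monomialRing k n))

/-! ### Consequences of the closure containing every good monomial. -/

section Main

variable {n : ℕ} (hn : 4 ≤ n)
  (hgood : ∀ i j, IsGoodExponent n i j → (X 0 ^ i * X 1 ^ j : MvPolynomial (Fin 2) k) ∈
    arfPolynomials k n)

include hn hgood

theorem mem_arfPolynomials {f : MvPolynomial (Fin 2) k} :
    f ∈ arfPolynomials k n ↔ ∀ i j, ¬ IsGoodExponent n i j → biCoeff i j f = 0 := by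
  constructor
  · intro hf i j hij
    exact biCoeff_eq_zero_of_mem_strictClosure hn
      (contraction_mono (weaklyArfClosure_le_strictClosure _) hf) hij
  · intro h
    refine mem_of_forall_biCoeff ((arfPolynomials k n).restrictScalars k) f
      fun i j hij => hgood i j ?_
    by_contra hcon
    exact hij (h i j hcon)

theorem weaklyArfClosure_eq_strictClosure :
    weaklyArfClosure (monomialRing k n) = strictClosure (monomialRing k n) :=
  eq_of_contraction_le (P := MvPolynomial (Fin 2) k) (weaklyArfClosure_le_strictClosure _)
    fun _ hf => (mem_arfPolynomials hn hgood).2 fun _ _ hij =>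
      biCoeff_eq_zero_of_mem_strictClosure hn hf hij

theorem bot_lt_weaklyArfClosure :
    (⊥ : Subalgebra (monomialRing k n) (FractionRing (monomialRing k n))) <
      weaklyArfClosure (monomialRing k n) := by
  refine lt_of_le_of_ne bot_le fun h => ?_
  -- This monomial has degree `3n`, beyond the exception in degree `2n`, but its `Y`-exponent does
  -- not occur in `R`.
  have hg := hgood (2 * n - 1) (n + 1)
    ⟨⟨3, by omega⟩, Or.inr (by omega), by omega⟩
  rw [arfPolynomials, ← h] at hg
  obtain ⟨r, hr⟩ := contraction_bot hg
  have := biCoeff_eq_zero_of_mem hn r.2 (2 * n - 1)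
  rw [show (r : MvPolynomial (Fin 2) k) = X 0 ^ (2 * n - 1) * X 1 ^ (n + 1) from hr,
    biCoeff_monomial, if_pos ⟨rfl, rfl⟩] at this
  exact one_ne_zero this

theorem exists_ringHom_weaklyArfClosure :
    ∃ φ : weaklyArfClosure (monomialRing k n) →+* MvPolynomial (Fin 2) k,
      Function.Injective φ ∧ ∀ f, (∃ q, φ q = f) ↔
        ∀ i j, ¬ IsGoodExponent n i j → biCoeff i j f = 0 := by
  obtain ⟨φ, hinj, hφ⟩ := exists_ringHom_range_eq_contraction (P := MvPolynomial (Fin 2) k)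
    ((weaklyArfClosure_le_strictClosure (monomialRing k n)).trans strictClosure_le_integralClosure)
  exact ⟨φ, hinj, fun f => (hφ f).trans (mem_arfPolynomials hn hgood)⟩

/-- Take `a = X^n` and `b = X^(2n-1) Y^(n+1)`. The quotient `X^(n-1) Y^(n+1)` has a bad exponent of
degree `2n`, but a nonconstant good monomial moves it to degree at least `3n`, where the exponent is
good. So `(a : b)` is the ideal of zero constant term. -/
theorem not_serreCondition_weaklyArfClosure :
    ¬ SerreCondition 2 (weaklyArfClosure (monomialRing k n)) := by
  obtain ⟨φ, hinj, hφ⟩ := exists_ringHom_weaklyArfClosure hn hgood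
  have hmon : ∀ i j, IsGoodExponent n i j → ∃ q, φ q = X 0 ^ i * X 1 ^ j := by
    intro i j hij
    refine (hφ _).2 fun i' j' h => ?_
    rw [biCoeff_monomial, if_neg]
    rintro ⟨rfl, rfl⟩
    exact h hij
  obtain ⟨a, ha⟩ := hmon n 0 ⟨by simp, by simp, by omega⟩
  obtain ⟨b, hb⟩ := hmon (2 * n - 1) (n + 1) ⟨⟨3, by omega⟩, Or.inr (by omega), by omega⟩
  obtain ⟨y, hy⟩ := hmon 0 n ⟨by simp, Or.inr (by omega), by omega⟩
  have hX : ∀ l : Fin 2, (X l : MvPolynomial (Fin 2) k) ≠ 0 := fun l => X_ne_zero l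
  have hb' : b ≠ 0 := by
    rintro rfl
    rw [map_zero] at hb
    exact mul_ne_zero (pow_ne_zero _ (hX 0)) (pow_ne_zero _ (hX 1)) hb.symm
  have ha' : a ≠ 0 := by
    rintro rfl
    rw [map_zero] at ha
    exact mul_ne_zero (pow_ne_zero _ (hX 0)) (pow_ne_zero _ (hX 1)) ha.symm
  have hy' : y ≠ 0 := by
    rintro rfl
    rw [map_zero] at hy
    exact mul_ne_zero (pow_ne_zero _ (hX 0)) (pow_ne_zero _ (hX 1)) hy.symm
  have hn0 : n ≠ 0 := by omega
  have hprime₁ := RingHom.ker_isPrime (evalYZero.toRingHom.comp φ)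
  have hprime₂ := RingHom.ker_isPrime (constantCoeff.comp φ)
  -- The middle prime of the chain is the kernel of `Y = 0`: it contains `Y^n` but not `X^n`.
  refine not_serreCondition_two (RingHom.ker (evalYZero.toRingHom.comp φ))
    (RingHom.ker (constantCoeff.comp φ)) ?_ ?_ ha' (b := b) fun s => ?_
  · refine bot_lt_iff_ne_bot.2 fun h => hy' ?_
    have : y ∈ RingHom.ker (evalYZero.toRingHom.comp φ) := by
      change evalYZero (φ y) = 0
      rw [hy]
      simp [evalYZero, hn0]
    rwa [h] at this
  · refine lt_of_le_of_ne ?_ fun h => ?_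
    · intro s hs
      have hcomp : ∀ f : MvPolynomial (Fin 2) k, constantCoeff (evalYZero f) = constantCoeff f := by
        have : ((constantCoeff : MvPolynomial (Fin 2) k →+* k).comp evalYZero.toRingHom) =
            constantCoeff := by
          refine MvPolynomial.ringHom_ext (fun c => by simp [evalYZero]) fun l => ?_
          fin_cases l <;> simp [evalYZero]
        exact fun f => RingHom.congr_fun this f
      replace hs : evalYZero (φ s) = 0 := hs
      change constantCoeff (φ s) = 0
      rw [← hcomp, hs, map_zero]
    · have : a ∈ RingHom.ker (constantCoeff.comp φ) := by
        change constantCoeff (φ a) = 0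
        rw [ha]
        simp [hn0]
      rw [← h] at this
      replace this : evalYZero (φ a) = 0 := this
      rw [ha] at this
      simp [evalYZero, hn0] at this
  · change constantCoeff (φ s) = 0 ↔ _
    have hdvd : a ∣ s * b ↔ ∃ q, φ q = φ s * (X 0 ^ (n - 1) * X 1 ^ (n + 1)) := by
      have hab : φ b = φ a * (X 0 ^ (n - 1) * X 1 ^ (n + 1)) := by
        rw [ha, hb, show 2 * n - 1 = n + (n - 1) by omega, pow_add]
        ring
      have ha0 : φ a ≠ 0 := fun h => ha' (hinj (by rw [h, map_zero]))
      refine exists_congr fun q => ?_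
      rw [← hinj.eq_iff, map_mul, map_mul, hab]
      constructor
      · intro h
        refine mul_left_cancel₀ ha0 ?_
        rw [← h]
        ring
      · intro h
        rw [h]
        ring
    rw [hdvd, hφ, ← biCoeff_zero_zero]
    constructor
    · intro h0 i j hij
      rw [mul_comm, biCoeff_mul]
      split_ifs with h
      · by_cases hz : i = n - 1 ∧ j = n + 1
        · rw [hz.1, hz.2, Nat.sub_self, Nat.sub_self, h0]
        · refine (hφ _).1 ⟨s, rfl⟩ _ _ fun hg => ?_
          obtain ⟨⟨c, hc⟩, h1, h2⟩ := hg
          refine hij ⟨⟨c + 2, ?_⟩, Or.inr (by omega), by omega⟩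
          rw [mul_add]
          omega
      · rfl
    · intro h
      -- The coefficient of the product at this bad exponent is the constant term of `s`; badness
      -- uses `3 ≤ n - 1`.
      have := h (n - 1) (n + 1) fun hg => hg.2.2 (by omega)
      rwa [mul_comm, biCoeff_mul, if_pos ⟨le_rfl, le_rfl⟩, Nat.sub_self, Nat.sub_self] at this

/-- The image of the closure in `P` is squeezed to equal `k[T]`, a finitely generated `k`-algebra.
-/
theorem isNoetherianRing_weaklyArfClosure {T : Set (MvPolynomial (Fin 2) k)} (hT : T.Finite)
    (hT₁ : ∀ t ∈ T, t ∈ arfPolynomials k n)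
    (hT₂ : ∀ i j, IsGoodExponent n i j →
      (X 0 ^ i * X 1 ^ j : MvPolynomial (Fin 2) k) ∈ Algebra.adjoin k T) :
    IsNoetherianRing (weaklyArfClosure (monomialRing k n)) := by
  obtain ⟨φ, hinj, hφ⟩ := exists_ringHom_weaklyArfClosure hn hgood
  have hmem : ∀ q, φ q ∈ Algebra.adjoin k T := fun q =>
    mem_of_forall_biCoeff _ _ fun i j hij => hT₂ i j (by
      by_contra hcon
      exact hij ((hφ _).1 ⟨q, rfl⟩ i j hcon))
  have hnoeth : IsNoetherianRing (Algebra.adjoin k T) :=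
    isNoetherianRing_of_fg (Subalgebra.fg_def.2 ⟨T, hT, rfl⟩)
  let e : weaklyArfClosure (monomialRing k n) ≃+* Algebra.adjoin k T :=
    RingEquiv.ofBijective (φ.codRestrict (Algebra.adjoin k T) hmem) (by
      constructor
      · intro x y hxy
        exact hinj (congrArg Subtype.val hxy)
      · rintro ⟨f, hf⟩
        have hle : Algebra.adjoin k T ≤ (arfPolynomials k n).restrictScalars k :=
          Algebra.adjoin_le hT₁
        obtain ⟨q, hq⟩ := (hφ f).2 ((mem_arfPolynomials hn hgood).1 (hle hf))
        exact ⟨q, Subtype.ext hq⟩)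
  exact isNoetherianRing_of_ringEquiv _ e.symm

end Main

/-- If the weakly Arf closure contains a finite set `T` generating all the monomials that can lie
in the strict closure, then it has all the claimed properties. -/
theorem conclusion_of_generators {n : ℕ} (hn : 4 ≤ n) {T : Set (MvPolynomial (Fin 2) k)}
    (hT : T.Finite)
    (hT₁ : ∀ t ∈ T, t ∈ arfPolynomials k n)
    (hT₂ : ∀ i j, IsGoodExponent n i j →
      (X 0 ^ i * X 1 ^ j : MvPolynomial (Fin 2) k) ∈ Algebra.adjoin k T) :
    (⊥ : Subalgebra (monomialRing k n) (FractionRing (monomialRing k n))) <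
        weaklyArfClosure (monomialRing k n) ∧
      weaklyArfClosure (monomialRing k n) = strictClosure (monomialRing k n) ∧
      IsNoetherianRing (weaklyArfClosure (monomialRing k n)) ∧
      ¬ SerreCondition 2 (weaklyArfClosure (monomialRing k n)) := by
  have hle : Algebra.adjoin k T ≤ (arfPolynomials k n).restrictScalars k :=
    Algebra.adjoin_le hT₁
  have hgood := fun i j hij => hle (hT₂ i j hij)
  exact ⟨bot_lt_weaklyArfClosure hn hgood, weaklyArfClosure_eq_strictClosure hn hgood,
    isNoetherianRing_weaklyArfClosure hn hgood hT hT₁ hT₂,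
    not_serreCondition_weaklyArfClosure hn hgood⟩

/-! ### The two rings -/

theorem generators_mem (n : ℕ) :
    (X 0 ^ n : MvPolynomial (Fin 2) k) ∈ monomialRing k n ∧
      (X 0 * X 1 ^ (n - 1) : MvPolynomial (Fin 2) k) ∈ monomialRing k n ∧
      (X 1 ^ n : MvPolynomial (Fin 2) k) ∈ monomialRing k n :=
  ⟨Algebra.subset_adjoin (by simp), Algebra.subset_adjoin (by simp),
    Algebra.subset_adjoin (by simp)⟩

theorem monomial_mem_of_le {A : Subalgebra k (MvPolynomial (Fin 2) k)} {n a b : ℕ}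
    (hx : X 0 ^ n ∈ A) (hy : X 1 ^ n ∈ A) (hab : X 0 ^ a * X 1 ^ b ∈ A) {i j : ℕ}
    (hai : a ≤ i) (hbj : b ≤ j) (hi : n ∣ i - a) (hj : n ∣ j - b) : X 0 ^ i * X 1 ^ j ∈ A := by
  obtain ⟨s, hs⟩ := hi
  obtain ⟨t, ht⟩ := hj
  have : (X 0 ^ i * X 1 ^ j : MvPolynomial (Fin 2) k) =
      X 0 ^ a * X 1 ^ b * (X 0 ^ n) ^ s * (X 1 ^ n) ^ t := by
    rw [show i = a + n * s by omega, show j = b + n * t by omega]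
    ring
  rw [this]
  exact A.mul_mem (A.mul_mem hab (A.pow_mem hx _)) (A.pow_mem hy _)

theorem monomial_mul_pow_mem {A : Subalgebra k (MvPolynomial (Fin 2) k)} {m : ℕ}
    (hxy : X 0 * X 1 ^ m ∈ A) (a : ℕ) :
    (X 0 ^ a * X 1 ^ (m * a) : MvPolynomial (Fin 2) k) ∈ A := by
  have := A.pow_mem hxy a
  rwa [mul_pow, ← pow_mul] at this

theorem weaklyArfClosure_monomialRing_four (k : Type*) [Field k] :
    (⊥ : Subalgebra (monomialRing k 4) (FractionRing (monomialRing k 4))) <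
        weaklyArfClosure (monomialRing k 4) ∧
      weaklyArfClosure (monomialRing k 4) = strictClosure (monomialRing k 4) ∧
      IsNoetherianRing (weaklyArfClosure (monomialRing k 4)) ∧
      ¬ SerreCondition 2 (weaklyArfClosure (monomialRing k 4)) := by
  obtain ⟨hx, hxy, hy⟩ := generators_mem (k := k) 4
  have hint := isIntegral_monomialRing (k := k) (n := 4) (by norm_num)
  refine conclusion_of_generators le_rfl
    (T := {X 0 ^ 4, X 0 * X 1 ^ 3, X 1 ^ 4, X 0 ^ 7 * X 1 ^ 5}) (by simp) ?_ ?_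
  · rintro t (rfl | rfl | rfl | rfl)
    · exact (arfPolynomials k 4).algebraMap_mem ⟨_, hx⟩
    · exact (arfPolynomials k 4).algebraMap_mem ⟨_, hxy⟩
    · exact (arfPolynomials k 4).algebraMap_mem ⟨_, hy⟩
    -- The Arf fraction with `x = XY^3` and `u = v = X^3 Y`: `ux = X^4 Y^4` and `u^2 x = X^7 Y^5`.
    · have hu : (X 0 ^ 3 * X 1) * (X 0 * X 1 ^ 3) ∈ arfPolynomials k 4 := by
        rw [show (X 0 ^ 3 * X 1) * (X 0 * X 1 ^ 3) =
          (X 0 ^ 4 * X 1 ^ 4 : MvPolynomial (Fin 2) k) by ring]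
        exact (arfPolynomials k 4).algebraMap_mem ⟨_, mul_mem hx hy⟩
      have := mul_mul_mem_contraction_weaklyArfClosure
        (mul_ne_zero (X_ne_zero 0) (pow_ne_zero 3 (X_ne_zero 1)))
        ((arfPolynomials k 4).algebraMap_mem ⟨_, hxy⟩) hu hu
      rw [show (X 0 ^ 7 * X 1 ^ 5 : MvPolynomial (Fin 2) k) =
        (X 0 ^ 3 * X 1) * (X 0 ^ 3 * X 1) * (X 0 * X 1 ^ 3) by ring]
      exact this
  · intro i j hij
    set A := Algebra.adjoin k
      ({X 0 ^ 4, X 0 * X 1 ^ 3, X 1 ^ 4, X 0 ^ 7 * X 1 ^ 5} : Set (MvPolynomial (Fin 2) k))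
    have hx : X 0 ^ 4 ∈ A := Algebra.subset_adjoin (by simp)
    have hxy : X 0 * X 1 ^ 3 ∈ A := Algebra.subset_adjoin (by simp)
    have hy : X 1 ^ 4 ∈ A := Algebra.subset_adjoin (by simp)
    have hz : X 0 ^ 7 * X 1 ^ 5 ∈ A := Algebra.subset_adjoin (by simp)
    obtain ⟨h1, h2, h3⟩ := hij
    -- If `(XY^3)^(i % 4)` does not divide the monomial, goodness leaves only `i ≡ 3` mod `4` and `j
    -- = 5`, with `i = 3` excluded.
    by_cases h : 3 * (i % 4) ≤ j
    · exact monomial_mem_of_le hx hy (monomial_mul_pow_mem hxy (i % 4)) (by omega) h (by omega)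
        (by omega)
    · exact monomial_mem_of_le hx hy hz (by omega) (by omega) (by omega) (by omega)

theorem weaklyArfClosure_monomialRing_five (k : Type*) [Field k] :
    (⊥ : Subalgebra (monomialRing k 5) (FractionRing (monomialRing k 5))) <
        weaklyArfClosure (monomialRing k 5) ∧
      weaklyArfClosure (monomialRing k 5) = strictClosure (monomialRing k 5) ∧
      IsNoetherianRing (weaklyArfClosure (monomialRing k 5)) ∧
      ¬ SerreCondition 2 (weaklyArfClosure (monomialRing k 5)) := by
  obtain ⟨hx, hxy, hy⟩ := generators_mem (k := k) 5
  have hint := isIntegral_monomialRing (k := k) (n := 5) (by norm_num)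
  have hR : ∀ {f : MvPolynomial (Fin 2) k}, f ∈ monomialRing k 5 → f ∈ arfPolynomials k 5 :=
    fun {f} hf => (arfPolynomials k 5).algebraMap_mem ⟨f, hf⟩
  have hxy2 : (X 0 ^ 2 * X 1 ^ 8 : MvPolynomial (Fin 2) k) ∈ monomialRing k 5 :=
    monomial_mul_pow_mem hxy 2
  have h96 : (X 0 ^ 9 * X 1 ^ 6 : MvPolynomial (Fin 2) k) ∈ arfPolynomials k 5 := by
    have hu : (X 0 ^ 4 * X 1) * (X 0 * X 1 ^ 4) ∈ arfPolynomials k 5 := by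
      rw [show (X 0 ^ 4 * X 1) * (X 0 * X 1 ^ 4) =
        (X 0 ^ 5 * X 1 ^ 5 : MvPolynomial (Fin 2) k) by ring]
      exact hR (mul_mem hx hy)
    rw [show (X 0 ^ 9 * X 1 ^ 6 : MvPolynomial (Fin 2) k) =
      (X 0 ^ 4 * X 1) * (X 0 ^ 4 * X 1) * (X 0 * X 1 ^ 4) by ring]
    exact mul_mul_mem_contraction_weaklyArfClosure
      (mul_ne_zero (X_ne_zero 0) (pow_ne_zero 4 (X_ne_zero 1))) (hR hxy) hu hu
  have h411 : (X 0 ^ 4 * X 1 ^ 11 : MvPolynomial (Fin 2) k) ∈ arfPolynomials k 5 := by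
    have hu : (X 0 ^ 2 * X 1 ^ 3) * X 1 ^ 5 ∈ arfPolynomials k 5 := by
      rw [show (X 0 ^ 2 * X 1 ^ 3) * X 1 ^ 5 =
        (X 0 ^ 2 * X 1 ^ 8 : MvPolynomial (Fin 2) k) by ring]
      exact hR hxy2
    rw [show (X 0 ^ 4 * X 1 ^ 11 : MvPolynomial (Fin 2) k) =
      (X 0 ^ 2 * X 1 ^ 3) * (X 0 ^ 2 * X 1 ^ 3) * X 1 ^ 5 by ring]
    exact mul_mul_mem_contraction_weaklyArfClosure (pow_ne_zero 5 (X_ne_zero 1)) (hR hy) hu hu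
  have h87 : (X 0 ^ 8 * X 1 ^ 7 : MvPolynomial (Fin 2) k) ∈ arfPolynomials k 5 := by
    have hne : (X 1 ^ 5 + X 0 * X 1 ^ 4 : MvPolynomial (Fin 2) k) ≠ 0 := by
      intro h
      have h' := congrArg (biCoeff 0 5) h
      have h1 := biCoeff_monomial (k := k) 0 5 0 5
      have h2 := biCoeff_monomial (k := k) 1 4 0 5
      simp only [pow_zero, one_mul, pow_one] at h1 h2
      rw [map_add, h1, h2] at h'
      simp at h'
    -- A non-monomial denominator `x = Y^4 (X + Y)` with `u = X^2 Y (X^2 - XY + Y^2)`: the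
    -- factorization of `X^3 + Y^3` gives `ux = X^2 Y^5 (X^3 + Y^3) ∈ R`. In the expansion of `u^2
    -- x`, the term `-X^8 Y^7` is the only one not yet known to lie in the closure.
    have hu : (X 0 ^ 4 * X 1 - X 0 ^ 3 * X 1 ^ 2 + X 0 ^ 2 * X 1 ^ 3) *
        (X 1 ^ 5 + X 0 * X 1 ^ 4) ∈ arfPolynomials k 5 := by
      rw [show (X 0 ^ 4 * X 1 - X 0 ^ 3 * X 1 ^ 2 + X 0 ^ 2 * X 1 ^ 3) *
        (X 1 ^ 5 + X 0 * X 1 ^ 4) =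
        (X 0 ^ 5 * X 1 ^ 5 + X 0 ^ 2 * X 1 ^ 8 : MvPolynomial (Fin 2) k) by ring]
      exact hR (add_mem (mul_mem hx hy) hxy2)
    have key := mul_mul_mem_contraction_weaklyArfClosure hne (hR (add_mem hy hxy)) hu hu
    have hrest : (X 0 ^ 5 * (X 0 ^ 2 * X 1 ^ 8) + X 0 ^ 5 * (X 0 * X 1 ^ 4) * X 1 ^ 5 -
        X 0 ^ 5 * (X 1 ^ 5) ^ 2 : MvPolynomial (Fin 2) k) ∈ monomialRing k 5 :=
      sub_mem (add_mem (mul_mem hx hxy2) (mul_mem (mul_mem hx hxy) hy))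
        (mul_mem hx (pow_mem hy 2))
    rw [show (X 0 ^ 8 * X 1 ^ 7 : MvPolynomial (Fin 2) k) =
      X 0 ^ 9 * X 1 ^ 6 + (X 0 ^ 5 * (X 0 ^ 2 * X 1 ^ 8) + X 0 ^ 5 * (X 0 * X 1 ^ 4) * X 1 ^ 5 -
        X 0 ^ 5 * (X 1 ^ 5) ^ 2) + X 0 ^ 4 * X 1 ^ 11 -
      (X 0 ^ 4 * X 1 - X 0 ^ 3 * X 1 ^ 2 + X 0 ^ 2 * X 1 ^ 3) *
      (X 0 ^ 4 * X 1 - X 0 ^ 3 * X 1 ^ 2 + X 0 ^ 2 * X 1 ^ 3) * (X 1 ^ 5 + X 0 * X 1 ^ 4) by ring]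
    exact sub_mem (add_mem (add_mem h96 (hR hrest)) h411) key
  refine conclusion_of_generators (by norm_num)
    (T := {X 0 ^ 5, X 0 * X 1 ^ 4, X 1 ^ 5, X 0 ^ 9 * X 1 ^ 6, X 0 ^ 8 * X 1 ^ 7,
      X 0 ^ 4 * X 1 ^ 11}) (by simp) ?_ ?_
  · rintro t (rfl | rfl | rfl | rfl | rfl | rfl)
    exacts [hR hx, hR hxy, hR hy, h96, h87, h411]
  · intro i j hij
    set A := Algebra.adjoin k
      ({X 0 ^ 5, X 0 * X 1 ^ 4, X 1 ^ 5, X 0 ^ 9 * X 1 ^ 6, X 0 ^ 8 * X 1 ^ 7,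
        X 0 ^ 4 * X 1 ^ 11} : Set (MvPolynomial (Fin 2) k))
    have hx : X 0 ^ 5 ∈ A := Algebra.subset_adjoin (by simp)
    have hxy : X 0 * X 1 ^ 4 ∈ A := Algebra.subset_adjoin (by simp)
    have hy : X 1 ^ 5 ∈ A := Algebra.subset_adjoin (by simp)
    obtain ⟨h1, h2, h3⟩ := hij
    -- Otherwise goodness leaves `i ≡ 3`, `j = 7`, or `i ≡ 4` with `j = 6` or `11`; the degree `2n`
    -- exception forces `i ≥ 8` and `i ≥ 9` in the cases `j = 7` and `j = 6`.
    by_cases h : 4 * (i % 5) ≤ j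
    · exact monomial_mem_of_le hx hy (monomial_mul_pow_mem hxy (i % 5)) (by omega) h (by omega)
        (by omega)
    by_cases h7 : j = 7
    · have hz : X 0 ^ 8 * X 1 ^ 7 ∈ A := Algebra.subset_adjoin (by simp)
      exact monomial_mem_of_le hx hy hz (by omega) (by omega) (by omega) (by omega)
    by_cases h6 : j = 6
    · have hz : X 0 ^ 9 * X 1 ^ 6 ∈ A := Algebra.subset_adjoin (by simp)
      exact monomial_mem_of_le hx hy hz (by omega) (by omega) (by omega) (by omega)
    · have hz : X 0 ^ 4 * X 1 ^ 11 ∈ A := Algebra.subset_adjoin (by simp)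
      exact monomial_mem_of_le hx hy hz (by omega) (by omega) (by omega) (by omega)

end MonomialRing

theorem mainTheorem6 (k : Type*) [Field k] (R : Subalgebra k (MvPolynomial (Fin 2) k))
    (hR : R = Algebra.adjoin k {MvPolynomial.X 0 ^ 4, MvPolynomial.X 0 * MvPolynomial.X 1 ^ 3,
        MvPolynomial.X 1 ^ 4} ∨
      R = Algebra.adjoin k {MvPolynomial.X 0 ^ 5, MvPolynomial.X 0 * MvPolynomial.X 1 ^ 4,
        MvPolynomial.X 1 ^ 5}) :
    (⊥ : Subalgebra R (FractionRing R)) < weaklyArfClosure R ∧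
      weaklyArfClosure R = strictClosure R ∧
      IsNoetherianRing (weaklyArfClosure R) ∧
      ¬ SerreCondition 2 (weaklyArfClosure R) := by
  rcases hR with rfl | rfl
  · exact MonomialRing.weaklyArfClosure_monomialRing_four k
  · exact MonomialRing.weaklyArfClosure_monomialRing_five k
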